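/- Let $n\ge 1$, $r\in(0,1)$, let $\mathbb B^n=\{z\in\mathbb C^n:|z|<1\}$ be the unit ball and let $\Omega=\{z\in\mathbb C^n: r<|z|<1\}$ be the ring domain. For a domain $D\subset\mathbb C^n$ let $K_D$ denote its Bergman kernel, i.e. the reproducing kernel of the space $L^2_h(D)$ of square integrable holomorphic functions on $D$: for every $w\in D$, $K_D(\cdot,w)\in L^2_h(D)$ and $f(w)=\int_D f(z)\overline{K_D(z,w)}\,dV(z)$ for all $f\in L^2_h(D)$. The Bergman metric of $D$ is $$F_B^D(p,\xi)=\Bigl(\sum_{\nu,\mu=1}^n\frac{\partial^2}{\partial z_\nu\partial\overline{z_\mu}}\log K_D(z,z)\Big|_{z=p}\,\xi_\nu\overline{\xi_\mu}\Bigr)^{1/2}.$$ Let $p\in\Omega$ and let $\xi\in\mathbb C^n$, $\xi\neq 0$, be such that $\xi\cdot\overline p=\sum_{i=1}^n\xi_i\overline{p_i}=0$. Then the Bergman metrics of $\Omega$ and of $\mathbb B^n$ are well defined (for $D=\Omega$ and for $D=\mathbb B^n$ the kernel $K_D$ exists, $K_D(z,z)\neq 0$ for all $z\in D$, and $z\mapsto\log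 K_D(z,z)$ is of class $C^2$ on $D$), and $$F_B^{\Omega}(p,\xi)<F_B^{\mathbb B^n}(p,\xi).$$ -/

import Mathlib

open MeasureTheory
open scoped ComplexConjugate

noncomputable section

/-- `ℂⁿ` with its Hermitian (Euclidean) norm. -/
abbrev Cn (n : ℕ) : Type := EuclideanSpace ℂ (Fin n)

/-- The unit ball `{|z| < 1}` of `ℂⁿ`. -/
def unitBall (n : ℕ) : Set (Cn n) := {z | ‖z‖ < 1}

/-- The ring domain `{r < |z| < 1}` of `ℂⁿ`. -/
def ringDomain (n : ℕ) (r : ℝ) : Set (Cn n) := {z | r < ‖z‖ ∧ ‖z‖ < 1}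

/-- `f` belongs to `L²_h(Ω)`: it is holomorphic and square integrable (for Lebesgue measure)
on `Ω`. -/
def MemBergmanSpace {n : ℕ} (Ω : Set (Cn n)) (f : Cn n → ℂ) : Prop :=
  DifferentiableOn ℂ f Ω ∧ MemLp f 2 (volume.restrict Ω)

/-- `k` is the reproducing element of `L²_h(Ω)` at `w`: it lies in `L²_h(Ω)`, and
`f(w) = ∫_Ω f(z) conj(k(z)) dV(z)` for all `f` in `L²_h(Ω)`. Its values on an open set `Ω` are
determined by this. -/
def IsReproducingAt {n : ℕ} (Ω : Set (Cn n)) (w : Cn n) (k : Cn n → ℂ) : Prop :=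
  MemBergmanSpace Ω k ∧
    ∀ f : Cn n → ℂ, MemBergmanSpace Ω f → f w = ∫ z in Ω, f z * conj (k z)

open Classical in
/-- The Bergman kernel `K_Ω(z, w)`, for `z, w ∈ Ω`: the function `K_Ω(·, w)` is the reproducing
element of `L²_h(Ω)` at `w`. -/
def bergmanKernel {n : ℕ} (Ω : Set (Cn n)) (z w : Cn n) : ℂ :=
  if h : ∃ k : Cn n → ℂ, IsReproducingAt Ω w k then h.choose z else 0

/-- The function `z ↦ log K_Ω(z, z)` (recall that `K_Ω(z, z)` is real and nonnegative). -/
def logKernelDiag {n : ℕ} (Ω : Set (Cn n)) (z : Cn n) : ℝ :=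
  Real.log (bergmanKernel Ω z z).re

/-- The Wirtinger derivative `∂f/∂z_ν = (∂f/∂x_ν - i ∂f/∂y_ν) / 2`. -/
def dz {n : ℕ} (ν : Fin n) (f : Cn n → ℂ) (z : Cn n) : ℂ :=
  (fderiv ℝ f z (EuclideanSpace.single ν 1)
    - Complex.I * fderiv ℝ f z (EuclideanSpace.single ν Complex.I)) / 2

/-- The Wirtinger derivative `∂f/∂z̄_ν = (∂f/∂x_ν + i ∂f/∂y_ν) / 2`. -/
def dzbar {n : ℕ} (ν : Fin n) (f : Cn n → ℂ) (z : Cn n) : ℂ :=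
  (fderiv ℝ f z (EuclideanSpace.single ν 1)
    + Complex.I * fderiv ℝ f z (EuclideanSpace.single ν Complex.I)) / 2

/-- The Levi form `∑_{ν,μ} ∂²u/∂z_ν∂z̄_μ (p) ξ_ν conj(ξ_μ)` of a real function `u`; it is a real
number when `u` is `C²` near `p`. -/
def leviForm {n : ℕ} (u : Cn n → ℝ) (p ξ : Cn n) : ℂ :=
  ∑ ν : Fin n, ∑ μ : Fin n,
    dz ν (dzbar μ (fun z => (u z : ℂ))) p * ξ ν * conj (ξ μ)

/-- The Bergman metric
`F_B^Ω(p, ξ) = (∑_{ν,μ} ∂²/∂z_ν∂z̄_μ log K_Ω(z, z)|_{z = p} ξ_ν conj(ξ_μ))^{1/2}`. -/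
def bergmanMetric {n : ℕ} (Ω : Set (Cn n)) (p ξ : Cn n) : ℝ :=
  Real.sqrt (leviForm (logKernelDiag Ω) p ξ).re

/-- The Bergman metric of `Ω` is well defined: the Bergman kernel exists, it does not vanish on
the diagonal, and the second derivatives of `log K_Ω(z, z)` exist and are continuous on `Ω`. -/
def HasBergmanMetric {n : ℕ} (Ω : Set (Cn n)) : Prop :=
  (∀ w ∈ Ω, ∃ k : Cn n → ℂ, IsReproducingAt Ω w k) ∧
    (∀ z ∈ Ω, bergmanKernel Ω z z ≠ 0) ∧
    ContDiffOn ℝ 2 (logKernelDiag Ω) Ω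

end

/-! Both kernels are explicit series. By unitary invariance the moment m_k = ∫ |⟨e,z⟩|^{2k} does not
depend on the unit vector e, and the kernel is K(z,w) = ∑ ⟨w,z⟩^k / m_k, with ⟨w,z⟩ linear in z
(`isReproducingAt_powerSum`). No orthonormal basis is needed. A nonzero ξ orthogonal to p ≠ 0 forces
dimension at least two, so averaging f over the rotations about the axis ℂe gives a function g that
is holomorphic on the whole disc and extends f|ℂe, as in Hartogs' theorem. A second average, over
scalar rotations, gives ∫ f · conj⟨e,z⟩^k = (g^{(k)}(0)/k!) m_k (`exists_moments`). Summing over k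
yields the Taylor series of g at |w|, that is f(w).

On the diagonal K is κ(|z|²) with κ(t) = ∑ t^k / m_k. In a tangential direction the Levi form of log
κ(|z|²) reduces to (κ'/κ)(|p|²)|ξ|², so it remains to compare κ'/κ for the two domains. Now tκ'/κ is
the mean of the index k under the weights t^k / m_k. Scaling gives m_k(Ω) = (1 - r^{2(n+k)}) m_k(𝔹),
so passing from ball to ring multiplies the weights by a strictly decreasing sequence, which
strictly lowers the mean (`tsum_mul_tsum_lt_of_strictAnti`). -/

/-! ### Circle averages and Hartogs-type extension -/

/-- Integrals of a continuous family of holomorphic functions over a compact interval are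
holomorphic. -/
theorem differentiableOn_intervalIntegral_of_continuousOn {F : ℂ → ℝ → ℂ} {U : Set ℂ}
    (hU : IsOpen U) {a b : ℝ} (hab : a ≤ b)
    (hF : ContinuousOn (Function.uncurry F) (U ×ˢ Set.univ))
    (hd : ∀ θ, DifferentiableOn ℂ (fun z => F z θ) U) :
    DifferentiableOn ℂ (fun z => ∫ θ in a..b, F z θ) U := by
  intro z₀ hz₀
  obtain ⟨δ, hδ, hball⟩ := Metric.isOpen_iff.1 hU z₀ hz₀
  have hcont : ∀ z ∈ U, Continuous (F z) := fun z hz => by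
    rw [← continuousOn_univ]
    exact hF.comp (by fun_prop : ContinuousOn (fun θ : ℝ => (z, θ)) Set.univ)
      (fun θ _ => ⟨hz, Set.mem_univ _⟩)
  have hcl : Metric.closedBall z₀ (δ / 2) ⊆ U :=
    (Metric.closedBall_subset_ball (by linarith)).trans hball
  obtain ⟨M, hM⟩ := ((isCompact_closedBall z₀ (δ / 2)).prod
    (isCompact_Icc (a := a) (b := b))).exists_bound_of_continuousOn
    (hF.mono (Set.prod_mono hcl (Set.subset_univ _)))
  have hderiv : ∀ θ, ∀ z ∈ U, HasDerivAt (fun z => F z θ) (deriv (fun z => F z θ) z) z :=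
    fun θ z hz => ((hd θ).differentiableAt (hU.mem_nhds hz)).hasDerivAt
  -- The derivative is measurable in θ as a limit of difference quotients, each continuous in θ.
  have hmeas : AEStronglyMeasurable (fun θ => deriv (fun z => F z θ) z₀)
      (volume.restrict (Set.Ioc a b)) := by
    have hu : Filter.Tendsto (fun n : ℕ => z₀ + ((δ / 2 / ((n : ℝ) + 1) : ℝ) : ℂ)) Filter.atTop
        (nhdsWithin z₀ {z₀}ᶜ) := by
      refine tendsto_nhdsWithin_iff.2 ⟨?_, Filter.Eventually.of_forall fun n => ?_⟩
      · have h1 : Filter.Tendsto (fun n : ℕ => δ / 2 / ((n : ℝ) + 1)) Filter.atTop (nhds 0) := by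
          have := (tendsto_one_div_add_atTop_nhds_zero_nat (𝕜 := ℝ)).const_mul (δ / 2)
          simpa [div_eq_mul_inv] using this
        have h2 := ((Complex.continuous_ofReal.tendsto 0).comp h1).const_add z₀
        simpa using h2
      · have : (δ / 2 / ((n : ℝ) + 1) : ℝ) ≠ 0 := by positivity
        rw [Set.mem_compl_singleton_iff, Ne, add_eq_left]
        exact_mod_cast this
    refine aestronglyMeasurable_of_tendsto_ae (u := Filter.atTop)
      (f := fun (n : ℕ) θ => slope (fun z => F z θ) z₀ (z₀ + ((δ / 2 / ((n : ℝ) + 1) : ℝ) : ℂ)))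
      (fun n => ?_) (Filter.Eventually.of_forall fun θ => ?_)
    · have hmem : z₀ + ((δ / 2 / ((n : ℝ) + 1) : ℝ) : ℂ) ∈ U := by
        apply hcl
        rw [Metric.mem_closedBall, dist_eq_norm, add_sub_cancel_left, Complex.norm_real,
          Real.norm_of_nonneg (by positivity)]
        exact div_le_self (by positivity) (by linarith [Nat.cast_nonneg (α := ℝ) n])
      have h1 := hcont _ hmem
      have h2 := hcont _ hz₀
      simp only [slope_def_module]
      exact (by fun_prop : Continuous _).aestronglyMeasurable
    · exact (hasDerivAt_iff_tendsto_slope.1 (hderiv θ z₀ hz₀)).comp hu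
  -- The bound is Cauchy's estimate: discs of radius δ/4 about points of the δ/4-ball stay in the
  -- closed δ/2-ball, where F is bounded by M.
  have key := hasDerivAt_integral_of_dominated_loc_of_deriv_le (𝕜 := ℂ)
    (μ := volume.restrict (Set.Ioc a b)) (F := F) (x₀ := z₀) (bound := fun _ => M / (δ / 4))
    (F' := fun z θ => deriv (fun z => F z θ) z)
    (Metric.ball_mem_nhds z₀ (by positivity : 0 < δ / 4)) ?_ ?_ hmeas ?_ ?_ ?_
  · have h := key.2.differentiableAt.differentiableWithinAt (s := U)
    simpa only [intervalIntegral.integral_of_le hab] using h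
  · filter_upwards [hU.mem_nhds hz₀] with z hz
    exact (hcont z hz).aestronglyMeasurable
  · exact ((hcont z₀ hz₀).integrableOn_Icc (a := a) (b := b)).mono_set Set.Ioc_subset_Icc_self
  · filter_upwards [ae_restrict_mem measurableSet_Ioc] with θ hθ z hz
    have hsub : Metric.closedBall z (δ / 4) ⊆ Metric.closedBall z₀ (δ / 2) :=
      Metric.closedBall_subset_closedBall' (by
        rw [Metric.mem_ball] at hz; linarith)
    refine Complex.norm_deriv_le_of_forall_mem_sphere_norm_le (by positivity) ?_ fun w hw => ?_
    · refine DifferentiableOn.diffContOnCl ?_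
      rw [closure_ball _ (by positivity)]
      exact (hd θ).mono (hsub.trans hcl)
    · exact hM (w, θ) ⟨hsub (Metric.sphere_subset_closedBall hw), Set.Ioc_subset_Icc_self hθ⟩
  · simp
  · refine Filter.Eventually.of_forall fun θ z hz => hderiv θ z (hcl ?_)
    exact Metric.ball_subset_closedBall (Metric.ball_subset_ball (by linarith) hz)

/-- Circle averages of a function holomorphic on a closed annulus (or disc) agree. -/
theorem circleAverage_eq_of_differentiableAt_annulus {h : ℂ → ℂ} {s t : ℝ} (hs : 0 ≤ s)
    (hst : s ≤ t) (hd : ∀ z : ℂ, s ≤ ‖z‖ → ‖z‖ ≤ t → DifferentiableAt ℂ h z) :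
    Real.circleAverage h 0 s = Real.circleAverage h 0 t := by
  rcases hs.eq_or_lt with rfl | hs
  · rw [Real.circleAverage_zero]
    symm
    refine circleAverage_of_differentiable_on_off_countable Set.countable_empty ?_ ?_
    · intro z hz
      rw [abs_of_nonneg hst, mem_closedBall_zero_iff] at hz
      exact (hd z (norm_nonneg _) hz).continuousAt.continuousWithinAt
    · intro z hz
      have hz := hz.1
      rw [abs_of_nonneg hst, mem_ball_zero_iff] at hz
      exact hd z (norm_nonneg _) hz.le
  · rw [Real.circleAverage_eq_circleIntegral hs.ne',
      Real.circleAverage_eq_circleIntegral (hs.trans_le hst).ne']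
    congr 1
    symm
    refine Complex.circleIntegral_sub_center_inv_smul_eq_of_differentiable_on_annulus_off_countable
      hs hst Set.countable_empty ?_ ?_
    · rintro z ⟨hz1, hz2⟩
      rw [mem_closedBall_zero_iff] at hz1
      rw [mem_ball_zero_iff, not_lt] at hz2
      exact (hd z hz2 hz1).continuousAt.continuousWithinAt
    · rintro z ⟨⟨hz1, hz2⟩, -⟩
      rw [mem_ball_zero_iff] at hz1
      rw [mem_closedBall_zero_iff, not_le] at hz2
      exact hd z hz2.le hz1.le

/-- A function holomorphic on the shell `r < √(|ζ|² + |w|²) < 1` of `ℂ²` has averages over circles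
in the second variable which depend only on the first variable, and this holomorphically in the
whole unit disc. -/
theorem exists_holomorphic_circleAverage_shell {r : ℝ} (hr : r < 1) {φ : ℂ × ℂ → ℂ}
    (hφ : DifferentiableOn ℂ φ {x | r < √(‖x.1‖ ^ 2 + ‖x.2‖ ^ 2) ∧ √(‖x.1‖ ^ 2 + ‖x.2‖ ^ 2) < 1}) :
    ∃ g : ℂ → ℂ, DifferentiableOn ℂ g (Metric.ball 0 1) ∧
      ∀ ζ : ℂ, ∀ s : ℝ, 0 ≤ s → r < √(‖ζ‖ ^ 2 + s ^ 2) → √(‖ζ‖ ^ 2 + s ^ 2) < 1 →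
        Real.circleAverage (fun w => φ (ζ, w)) 0 s = g ζ := by
  set W : Set (ℂ × ℂ) :=
    {x | r < √(‖x.1‖ ^ 2 + ‖x.2‖ ^ 2) ∧ √(‖x.1‖ ^ 2 + ‖x.2‖ ^ 2) < 1} with hW
  have hWo : IsOpen W :=
    IsOpen.and (isOpen_lt (by fun_prop) (by fun_prop)) (isOpen_lt (by fun_prop) (by fun_prop))
  -- The second variable fills the hole: even when ‖ζ‖ ≤ r, some circle over ζ lies in the shell.
  have hex : ∀ ζ ∈ Metric.ball (0 : ℂ) 1, ∃ s : ℝ, 0 ≤ s ∧ r < √(‖ζ‖ ^ 2 + s ^ 2) ∧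
      √(‖ζ‖ ^ 2 + s ^ 2) < 1 := by
    intro ζ hζ
    rw [mem_ball_zero_iff] at hζ
    obtain ⟨t, ht1, ht2⟩ := exists_between (max_lt hr hζ)
    have h0 : 0 ≤ t := (norm_nonneg ζ).trans ((le_max_right _ _).trans ht1.le)
    have h1 : ‖ζ‖ ≤ t := (le_max_right _ _).trans ht1.le
    refine ⟨√(t ^ 2 - ‖ζ‖ ^ 2), Real.sqrt_nonneg _, ?_⟩
    rw [Real.sq_sqrt (by nlinarith [norm_nonneg ζ]), add_sub_cancel, Real.sqrt_sq h0]
    exact ⟨(le_max_left _ _).trans_lt ht1, ht2⟩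
  have hmono : ∀ ζ : ℂ, ∀ s t : ℝ, 0 ≤ s → s ≤ t → r < √(‖ζ‖ ^ 2 + s ^ 2) →
      √(‖ζ‖ ^ 2 + t ^ 2) < 1 → Real.circleAverage (fun w => φ (ζ, w)) 0 s =
        Real.circleAverage (fun w => φ (ζ, w)) 0 t := by
    intro ζ s t hs hst h1 h2
    refine circleAverage_eq_of_differentiableAt_annulus hs hst fun w hw1 hw2 => ?_
    have hmem : (ζ, w) ∈ W := ⟨h1.trans_le (Real.sqrt_le_sqrt (by dsimp only; gcongr)),
      (Real.sqrt_le_sqrt (by dsimp only; gcongr)).trans_lt h2⟩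
    exact (hφ.differentiableAt (hWo.mem_nhds hmem)).comp w (by fun_prop)
  classical
  choose! S hS0 hS1 hS2 using hex
  have heq : ∀ ζ ∈ Metric.ball (0 : ℂ) 1, ∀ s : ℝ, 0 ≤ s → r < √(‖ζ‖ ^ 2 + s ^ 2) →
      √(‖ζ‖ ^ 2 + s ^ 2) < 1 → Real.circleAverage (fun w => φ (ζ, w)) 0 s =
        Real.circleAverage (fun w => φ (ζ, w)) 0 (S ζ) := by
    intro ζ hζ s hs h1 h2
    rcases le_total s (S ζ) with h | h
    · exact hmono ζ _ _ hs h h1 (hS2 ζ hζ)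
    · exact (hmono ζ _ _ (hS0 ζ hζ) h (hS1 ζ hζ) h2).symm
  refine ⟨fun ζ => Real.circleAverage (fun w => φ (ζ, w)) 0 (S ζ), ?_, ?_⟩
  · intro ζ₀ hζ₀
    -- The chosen radius `S` need not be continuous. Near ζ₀ it can be frozen at `S ζ₀`, since by
    -- `heq` this changes no average.
    set s := S ζ₀
    set U : Set ℂ := {ζ | r < √(‖ζ‖ ^ 2 + s ^ 2) ∧ √(‖ζ‖ ^ 2 + s ^ 2) < 1} with hU
    have hUo : IsOpen U :=
      IsOpen.and (isOpen_lt (by fun_prop) (by fun_prop)) (isOpen_lt (by fun_prop) (by fun_prop))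
    have hmem : ∀ ζ ∈ U, ∀ θ : ℝ, (ζ, circleMap 0 s θ) ∈ W := by
      intro ζ hζ θ
      simpa [hW, hU] using hζ
    have hUball : ∀ ζ ∈ U, ζ ∈ Metric.ball (0 : ℂ) 1 := by
      intro ζ hζ
      rw [mem_ball_zero_iff]
      refine lt_of_le_of_lt ?_ hζ.2
      exact Real.le_sqrt_of_sq_le (by nlinarith [sq_nonneg s])
    have hdiff : DifferentiableOn ℂ (fun ζ => Real.circleAverage (fun w => φ (ζ, w)) 0 s) U := by
      simp only [Real.circleAverage_def]
      refine (differentiableOn_intervalIntegral_of_continuousOn hUo Real.two_pi_pos.le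
        ?_ ?_).const_smul _
      · refine hφ.continuousOn.comp (f := fun x : ℂ × ℝ => (x.1, circleMap 0 s x.2))
          (Continuous.continuousOn (by fun_prop)) ?_
        rintro ⟨ζ, θ⟩ ⟨h, -⟩
        exact hmem ζ h θ
      · intro θ
        exact hφ.comp (f := fun ζ : ℂ => (ζ, circleMap 0 s θ)) (by fun_prop)
          (fun ζ hζ => hmem ζ hζ θ)
    have hζU : ζ₀ ∈ U := ⟨hS1 ζ₀ hζ₀, hS2 ζ₀ hζ₀⟩
    refine ((hdiff.differentiableAt (hUo.mem_nhds hζU)).congr_of_eventuallyEq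
      ?_).differentiableWithinAt
    filter_upwards [hUo.mem_nhds hζU] with ζ hζ
    exact (heq ζ (hUball ζ hζ) s (hS0 ζ₀ hζ₀) hζ.1 hζ.2).symm
  · intro ζ s hs h1 h2
    refine heq ζ ?_ s hs h1 h2
    rw [mem_ball_zero_iff]
    exact lt_of_le_of_lt (Real.le_sqrt_of_sq_le (by nlinarith [sq_nonneg s])) h2

theorem isOpen_ringDomain (n : ℕ) (r : ℝ) : IsOpen (ringDomain n r) :=
  IsOpen.and (isOpen_lt (by fun_prop) (by fun_prop)) (isOpen_lt (by fun_prop) (by fun_prop))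

theorem norm_smul_add_of_inner_eq_zero {n : ℕ} {e v : Cn n} (he : ‖e‖ = 1)
    (hv : inner ℂ e v = 0) (ζ : ℂ) : ‖ζ • e + v‖ = √(‖ζ‖ ^ 2 + ‖v‖ ^ 2) := by
  have h := norm_add_sq_eq_norm_sq_add_norm_sq_of_inner_eq_zero (𝕜 := ℂ) (ζ • e) v
    (by rw [inner_smul_left, hv, mul_zero])
  rw [norm_smul, he, mul_one] at h
  rw [sq, sq, ← h, Real.sqrt_mul_self (norm_nonneg _)]

/-- The averages of a holomorphic function on a ring domain over the rotations fixing a unit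
vector `e` extend holomorphically to the unit disc of `ℂ e`. -/
theorem exists_holomorphic_rotation_average {n : ℕ} {r : ℝ} (hr : r < 1) {e u₀ : Cn n}
    (he : ‖e‖ = 1) (hu₀ : ‖u₀‖ = 1) (heu₀ : inner ℂ e u₀ = 0) {f : Cn n → ℂ}
    (hf : DifferentiableOn ℂ f (ringDomain n r)) :
    ∃ g : ℂ → ℂ, DifferentiableOn ℂ g (Metric.ball 0 1) ∧
      ∀ (ζ : ℂ) (v : Cn n), inner ℂ e v = 0 → ζ • e + v ∈ ringDomain n r →
        (2 * Real.pi)⁻¹ • ∫ θ in 0..2 * Real.pi, f (ζ • e + Complex.exp (θ * Complex.I) • v) =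
          g ζ := by
  have hnorm : ∀ (u : Cn n), ‖u‖ = 1 → inner ℂ e u = 0 → ∀ ζ w : ℂ,
      ‖ζ • e + w • u‖ = √(‖ζ‖ ^ 2 + ‖w‖ ^ 2) := by
    intro u hu heu ζ w
    rw [norm_smul_add_of_inner_eq_zero he (by rw [inner_smul_right, heu, mul_zero]),
      norm_smul, hu, mul_one]
  have hex : ∀ u : Cn n, ‖u‖ = 1 → inner ℂ e u = 0 →
      ∃ g : ℂ → ℂ, DifferentiableOn ℂ g (Metric.ball 0 1) ∧
      ∀ ζ : ℂ, ∀ s : ℝ, 0 ≤ s → r < √(‖ζ‖ ^ 2 + s ^ 2) → √(‖ζ‖ ^ 2 + s ^ 2) < 1 →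
        Real.circleAverage (fun w => f (ζ • e + w • u)) 0 s = g ζ := by
    intro u hu heu
    refine exists_holomorphic_circleAverage_shell hr (φ := fun x => f (x.1 • e + x.2 • u)) ?_
    refine hf.comp (f := fun x : ℂ × ℂ => x.1 • e + x.2 • u) (by fun_prop) ?_
    rintro ⟨ζ, w⟩ h
    change r < ‖ζ • e + w • u‖ ∧ ‖ζ • e + w • u‖ < 1
    rw [hnorm u hu heu]
    exact h
  obtain ⟨g, hg, hgavg⟩ := hex u₀ hu₀ heu₀
  have hline : ∀ u : Cn n, ∀ g' : ℂ → ℂ,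
      (∀ ζ : ℂ, ∀ s : ℝ, 0 ≤ s → r < √(‖ζ‖ ^ 2 + s ^ 2) → √(‖ζ‖ ^ 2 + s ^ 2) < 1 →
        Real.circleAverage (fun w => f (ζ • e + w • u)) 0 s = g' ζ) →
      ∀ ζ : ℂ, r < ‖ζ‖ → ‖ζ‖ < 1 → g' ζ = f (ζ • e) := by
    intro u g' h ζ h1 h2
    have h3 : √(‖ζ‖ ^ 2 + (0 : ℝ) ^ 2) = ‖ζ‖ := by simp
    rw [← h ζ 0 le_rfl (by rwa [h3]) (by rwa [h3]), Real.circleAverage_zero]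
    simp
  refine ⟨g, hg, fun ζ v hev hv => ?_⟩
  have hv' := hv
  rw [ringDomain, Set.mem_ofPred_eq, norm_smul_add_of_inner_eq_zero he hev] at hv'
  rcases eq_or_ne v 0 with rfl | hv0
  · have hz : √(‖ζ‖ ^ 2 + ‖(0 : Cn n)‖ ^ 2) = ‖ζ‖ := by simp
    rw [hz] at hv'
    rw [hline u₀ g hgavg ζ hv'.1 hv'.2]
    simp only [smul_zero, add_zero, intervalIntegral.integral_const, sub_zero, smul_smul]
    rw [inv_mul_cancel₀ Real.two_pi_pos.ne', one_smul]
  set u : Cn n := ((‖v‖ : ℂ)⁻¹) • v with hu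
  have hvn : (‖v‖ : ℂ) ≠ 0 := by simpa using hv0
  have hun : ‖u‖ = 1 := by
    rw [hu, norm_smul, norm_inv, Complex.norm_real, norm_norm,
      inv_mul_cancel₀ (norm_ne_zero_iff.2 hv0)]
  have heu : inner ℂ e u = 0 := by rw [hu, inner_smul_right, hev, mul_zero]
  obtain ⟨g', hg', hg'avg⟩ := hex u hun heu
  -- The extension does not depend on the transverse direction: both functions equal f(ζe) for r <
  -- ‖ζ‖ < 1, so the identity theorem applies.
  have hgg' : Set.EqOn g' g (Metric.ball 0 1) := by
    obtain ⟨t, ht1, ht2⟩ := exists_between (max_lt hr zero_lt_one)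
    have ht0 : 0 < t := (le_max_right _ _).trans_lt ht1
    have htr : r < t := (le_max_left _ _).trans_lt ht1
    have htn : ‖(t : ℂ)‖ = t := by rw [Complex.norm_real, Real.norm_of_nonneg ht0.le]
    refine AnalyticOnNhd.eqOn_of_preconnected_of_eventuallyEq
      (hg'.analyticOnNhd Metric.isOpen_ball) (hg.analyticOnNhd Metric.isOpen_ball)
      (convex_ball _ _).isPreconnected (z₀ := (t : ℂ)) (by rwa [mem_ball_zero_iff, htn]) ?_
    have ho : IsOpen {ζ : ℂ | r < ‖ζ‖ ∧ ‖ζ‖ < 1} :=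
      IsOpen.and (isOpen_lt (by fun_prop) (by fun_prop)) (isOpen_lt (by fun_prop) (by fun_prop))
    filter_upwards [ho.mem_nhds (show (t : ℂ) ∈ {ζ : ℂ | r < ‖ζ‖ ∧ ‖ζ‖ < 1} by
      rw [Set.mem_ofPred_eq, htn]; exact ⟨htr, ht2⟩)] with η hη
    rw [hline u g' hg'avg η hη.1 hη.2, hline u₀ g hgavg η hη.1 hη.2]
  have hζ : ζ ∈ Metric.ball (0 : ℂ) 1 := by
    rw [mem_ball_zero_iff]
    exact lt_of_le_of_lt (Real.le_sqrt_of_sq_le (by nlinarith [sq_nonneg ‖v‖])) hv'.2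
  rw [← hgg' hζ, ← hg'avg ζ ‖v‖ (norm_nonneg _) hv'.1 hv'.2, Real.circleAverage_def]
  congr 1
  refine intervalIntegral.integral_congr fun θ _ => ?_
  simp only [circleMap_zero, hu, smul_smul]
  rw [mul_comm (‖v‖ : ℂ), mul_assoc, mul_inv_cancel₀ hvn, mul_one]

/-! ### Unitary invariance of integrals over ring domains -/

theorem measurePreserving_linearIsometry {n : ℕ} (T : Cn n →ₗᵢ[ℂ] Cn n) :
    MeasurePreserving T volume volume := by
  let T₁ : Cn n ≃ₗᵢ[ℂ] Cn n := T.toLinearIsometryEquiv rfl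
  let T₂ : Cn n ≃ₗᵢ[ℝ] Cn n := ⟨T₁.toLinearEquiv.restrictScalars ℝ, T₁.norm_map⟩
  exact T₂.measurePreserving

theorem linearIsometry_preimage_ringDomain {n : ℕ} (r : ℝ) (T : Cn n →ₗᵢ[ℂ] Cn n) :
    T ⁻¹' ringDomain n r = ringDomain n r := by
  ext z
  change (r < ‖T z‖ ∧ ‖T z‖ < 1) ↔ (r < ‖z‖ ∧ ‖z‖ < 1)
  rw [T.norm_map]

theorem measurePreserving_linearIsometry_restrict {n : ℕ} (r : ℝ) (T : Cn n →ₗᵢ[ℂ] Cn n) :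
    MeasurePreserving T (volume.restrict (ringDomain n r)) (volume.restrict (ringDomain n r)) := by
  have h := (measurePreserving_linearIsometry T).restrict_preimage
    (isOpen_ringDomain n r).measurableSet
  rwa [linearIsometry_preimage_ringDomain] at h

theorem measurableEmbedding_linearIsometry {n : ℕ} (T : Cn n →ₗᵢ[ℂ] Cn n) :
    MeasurableEmbedding T :=
  (T.toLinearIsometryEquiv rfl).toHomeomorph.measurableEmbedding

theorem setIntegral_comp_linearIsometry {n : ℕ} (r : ℝ) (T : Cn n →ₗᵢ[ℂ] Cn n)
    {E : Type*} [NormedAddCommGroup E] [NormedSpace ℝ E] (F : Cn n → E) :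
    ∫ z in ringDomain n r, F (T z) = ∫ z in ringDomain n r, F z :=
  (measurePreserving_linearIsometry_restrict r T).integral_comp
    (measurableEmbedding_linearIsometry T) F

/-- Averaging over a family of linear isometries does not change integrals over a ring domain. -/
theorem setIntegral_average {n : ℕ} {r : ℝ} (T : ℝ → Cn n →ₗᵢ[ℂ] Cn n)
    (hT : Continuous fun x : Cn n × ℝ => T x.2 x.1) {F : Cn n → ℂ}
    (hc : ContinuousOn F (ringDomain n r)) (hi : IntegrableOn F (ringDomain n r)) :
    IntegrableOn (fun z => (2 * Real.pi)⁻¹ • ∫ θ in 0..2 * Real.pi, F (T θ z)) (ringDomain n r) ∧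
    ∫ z in ringDomain n r, (2 * Real.pi)⁻¹ • ∫ θ in 0..2 * Real.pi, F (T θ z) =
      ∫ z in ringDomain n r, F z := by
  have hΩ := (isOpen_ringDomain n r).measurableSet
  set μ : Measure (Cn n) := volume.restrict (ringDomain n r) with hμ
  set ν : Measure ℝ := volume.restrict (Set.Ioc 0 (2 * Real.pi)) with hν
  have hP : Integrable (fun x : Cn n × ℝ => F (T x.2 x.1)) (μ.prod ν) := by
    rw [integrable_prod_iff']
    · refine ⟨Filter.Eventually.of_forall fun θ => ?_, ?_⟩
      · exact ((measurePreserving_linearIsometry_restrict r (T θ)).integrable_comp_emb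
          (measurableEmbedding_linearIsometry _)).2 hi
      · have h : ∀ θ, ∫ z, ‖F (T θ z)‖ ∂μ = ∫ z, ‖F z‖ ∂μ := fun θ =>
          setIntegral_comp_linearIsometry r (T θ) (fun z => ‖F z‖)
        simp only [h]
        exact integrable_const _
    · rw [hμ, hν, Measure.prod_restrict]
      refine ContinuousOn.aestronglyMeasurable ?_ (hΩ.prod measurableSet_Ioc)
      refine hc.comp hT.continuousOn ?_
      rintro ⟨z, θ⟩ ⟨hz, -⟩
      rw [← linearIsometry_preimage_ringDomain r (T θ)] at hz
      exact hz
  have hle : (0 : ℝ) ≤ 2 * Real.pi := Real.two_pi_pos.le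
  simp only [intervalIntegral.integral_of_le hle]
  refine ⟨(hP.integral_prod_left.smul (2 * Real.pi)⁻¹ :), ?_⟩
  rw [integral_smul, integral_integral_swap hP]
  have h : ∀ θ, ∫ z, F (T θ z) ∂μ = ∫ z, F z ∂μ := fun θ =>
    setIntegral_comp_linearIsometry r (T θ) F
  simp only [h]
  rw [setIntegral_const, smul_smul, measureReal_def, Real.volume_Ioc, sub_zero,
    ENNReal.toReal_ofReal hle, inv_mul_cancel₀ Real.two_pi_pos.ne', one_smul]

/-- The rotation by a unimodular `c` of the orthogonal complement of the unit vector `e`. -/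
noncomputable def axisRotation {n : ℕ} (e : Cn n) (he : ‖e‖ = 1) (c : ℂ) (hc : ‖c‖ = 1) :
    Cn n →ₗᵢ[ℂ] Cn n where
  toFun z := inner ℂ e z • e + c • (z - inner ℂ e z • e)
  map_add' x y := by simp only [inner_add_right]; module
  map_smul' a x := by simp only [inner_smul_right, RingHom.id_apply]; module
  norm_map' z := by
    have hv : inner ℂ e (z - inner ℂ e z • e) = 0 := by
      rw [inner_sub_right, inner_smul_right, inner_self_eq_norm_sq_to_K, he]; simp
    change ‖inner ℂ e z • e + c • (z - inner ℂ e z • e)‖ = ‖z‖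
    rw [norm_smul_add_of_inner_eq_zero he (by rw [inner_smul_right, hv, mul_zero]), norm_smul, hc,
      one_mul, ← norm_smul_add_of_inner_eq_zero he hv, add_sub_cancel]

/-- Multiplication by a unimodular scalar. -/
noncomputable def scalarRotation {n : ℕ} (c : ℂ) (hc : ‖c‖ = 1) : Cn n →ₗᵢ[ℂ] Cn n where
  toLinearMap := c • LinearMap.id
  norm_map' z := by simp [norm_smul, hc]

/-! ### Moments and Taylor coefficients -/

theorem volume_ringDomain_lt_top (n : ℕ) (r : ℝ) : volume (ringDomain n r) < ⊤ :=
  (measure_mono fun z (hz : z ∈ ringDomain n r) => mem_ball_zero_iff.2 hz.2).trans_lt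
    (measure_ball_lt_top (x := (0 : Cn n)) (r := 1))

/-- The mean over rotations of `g(w) w̄ᵏ` picks the `k`-th Taylor coefficient of `g`. -/
theorem average_mul_conj_pow {g : ℂ → ℂ} (hg : DifferentiableOn ℂ g (Metric.ball 0 1)) (k : ℕ)
    {ζ : ℂ} (hζ : ‖ζ‖ < 1) :
    (2 * Real.pi)⁻¹ • ∫ θ in 0..2 * Real.pi, g (Complex.exp (θ * Complex.I) * ζ) *
        conj (Complex.exp (θ * Complex.I) * ζ) ^ k =
      ((k.factorial : ℂ)⁻¹ * iteratedDeriv k g 0) * ((‖ζ‖ ^ (2 * k) : ℝ) : ℂ) := by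
  have h1 : (2 * Real.pi)⁻¹ • ∫ θ in 0..2 * Real.pi, g (Complex.exp (θ * Complex.I) * ζ) *
        conj (Complex.exp (θ * Complex.I) * ζ) ^ k =
      Real.circleAverage (fun w => g w * conj w ^ k) 0 ‖ζ‖ := by
    rw [Real.circleAverage_eq_integral_add ζ.arg]
    congr 1
    refine intervalIntegral.integral_congr fun θ _ => ?_
    have h : circleMap 0 ‖ζ‖ (θ + ζ.arg) = Complex.exp (θ * Complex.I) * ζ := by
      conv_rhs => rw [← Complex.norm_mul_exp_arg_mul_I ζ]
      rw [circleMap_zero, mul_left_comm, ← Complex.exp_add]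
      push_cast
      ring_nf
    simp only [h]
  rw [h1]
  rcases eq_or_ne ζ 0 with rfl | hζ0
  · rcases Nat.eq_zero_or_pos k with rfl | hk
    · simp
    · simp [hk.ne']
  · have hR : 0 < ‖ζ‖ := norm_pos_iff.2 hζ0
    rw [Real.circleAverage_eq_circleIntegral hR.ne']
    have h2 := DifferentiableOn.circleIntegral_one_div_sub_center_pow_smul (f := g) (c := 0) hR k
      (hg.mono (Metric.closedBall_subset_ball hζ))
    -- On the circle conj z = ‖ζ‖²/z, which turns the integrand into the Cauchy kernel for the k-th
    -- derivative.
    have h3 : ∮ z in C(0, ‖ζ‖), (z - 0)⁻¹ • (g z * conj z ^ k) =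
        ∮ z in C(0, ‖ζ‖), ((‖ζ‖ ^ (2 * k) : ℝ) : ℂ) • ((1 / (z - 0) ^ (k + 1)) • g z) := by
      refine circleIntegral.integral_congr hR.le fun z hz => ?_
      rw [mem_sphere_zero_iff_norm] at hz
      have hz0 : z ≠ 0 := by rw [← norm_pos_iff, hz]; exact hR
      have h4 : z * conj z = (‖ζ‖ : ℂ) ^ 2 := by rw [Complex.mul_conj', hz]
      have h5 : ((‖ζ‖ ^ (2 * k) : ℝ) : ℂ) = z ^ k * conj z ^ k := by
        rw [← mul_pow, h4]; push_cast; ring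
      simp only [sub_zero, smul_eq_mul]
      rw [h5]
      field_simp
      ring
    rw [h3, circleIntegral.integral_smul, h2]
    simp only [smul_eq_mul]
    have : (k.factorial : ℂ) ≠ 0 := by exact_mod_cast k.factorial_ne_zero
    have := Complex.two_pi_I_ne_zero
    field_simp

/-- The moments `∫ |⟨e, z⟩|²ᵏ` of a ring domain. -/
noncomputable def ringMoment {n : ℕ} (r : ℝ) (e : Cn n) (k : ℕ) : ℝ :=
  ∫ z in ringDomain n r, ‖(inner ℂ e z : ℂ)‖ ^ (2 * k)

theorem norm_inner_lt_one {n : ℕ} {r : ℝ} {e z : Cn n} (he : ‖e‖ = 1) (hz : z ∈ ringDomain n r) :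
    ‖(inner ℂ e z : ℂ)‖ < 1 :=
  (norm_inner_le_norm e z).trans_lt (by rw [he, one_mul]; exact hz.2)

theorem integrableOn_mul_bounded {n : ℕ} {r : ℝ} {F H : Cn n → ℂ}
    (hF : IntegrableOn F (ringDomain n r)) (hH : Continuous H) {C : ℝ}
    (hC : ∀ z ∈ ringDomain n r, ‖H z‖ ≤ C) :
    IntegrableOn (fun z => F z * H z) (ringDomain n r) := by
  refine Integrable.mul_bdd (c := C) hF hH.aestronglyMeasurable ?_
  filter_upwards [ae_restrict_mem (isOpen_ringDomain n r).measurableSet] with z hz using hC z hz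

/-- The moments of an integrable holomorphic function on a ring domain along a direction `e` are
multiples of the Taylor coefficients of the extension of its restriction to `ℂ e`. -/
theorem exists_moments {n : ℕ} {r : ℝ} (hr : r < 1) {e u₀ : Cn n}
    (he : ‖e‖ = 1) (hu₀ : ‖u₀‖ = 1) (heu₀ : inner ℂ e u₀ = 0) {f : Cn n → ℂ}
    (hf : DifferentiableOn ℂ f (ringDomain n r)) (hi : IntegrableOn f (ringDomain n r)) :
    ∃ g : ℂ → ℂ, DifferentiableOn ℂ g (Metric.ball 0 1) ∧
      (∀ ζ : ℂ, ζ • e ∈ ringDomain n r → g ζ = f (ζ • e)) ∧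
      ∀ k : ℕ, ∫ z in ringDomain n r, f z * conj (inner ℂ e z : ℂ) ^ k =
        ((k.factorial : ℂ)⁻¹ * iteratedDeriv k g 0) * ringMoment r e k := by
  have hΩ := (isOpen_ringDomain n r).measurableSet
  obtain ⟨g, hg, hgf⟩ := exists_holomorphic_rotation_average hr he hu₀ heu₀ hf
  refine ⟨g, hg, fun ζ hζ => ?_, fun k => ?_⟩
  · rw [← hgf ζ 0 (inner_zero_right _) (by rwa [add_zero])]
    simp only [smul_zero, add_zero, intervalIntegral.integral_const, sub_zero, smul_smul]
    rw [inv_mul_cancel₀ Real.two_pi_pos.ne', one_smul]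
  have hee : (inner ℂ e e : ℂ) = 1 := by rw [inner_self_eq_norm_sq_to_K, he]; simp
  have hperp : ∀ z : Cn n, inner ℂ e (z - inner ℂ e z • e) = 0 := fun z => by
    rw [inner_sub_right, inner_smul_right, hee, mul_one, sub_self]
  have hHc : Continuous fun z : Cn n => conj (inner ℂ e z : ℂ) ^ k := by fun_prop
  have hint : IntegrableOn (fun z => f z * conj (inner ℂ e z : ℂ) ^ k) (ringDomain n r) := by
    refine integrableOn_mul_bounded hi hHc (C := 1) fun z hz => ?_
    rw [norm_pow, RCLike.norm_conj]
    exact pow_le_one₀ (norm_nonneg _) (norm_inner_lt_one he hz).le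
  have hnorm : ∀ θ : ℝ, ‖Complex.exp (θ * Complex.I)‖ = 1 := Complex.norm_exp_ofReal_mul_I
  -- First average: rotations about e fix ⟨e,z⟩, hence the weight, and replace f by g(⟨e,z⟩).
  obtain ⟨hint', heq⟩ := setIntegral_average (F := fun z => f z * conj (inner ℂ e z : ℂ) ^ k)
    (fun θ => axisRotation e he (Complex.exp (θ * Complex.I)) (hnorm θ))
    (by
      change Continuous fun x : Cn n × ℝ => (inner ℂ e x.1 : ℂ) • e +
        Complex.exp (x.2 * Complex.I) • (x.1 - (inner ℂ e x.1 : ℂ) • e)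
      fun_prop)
    (hf.continuousOn.mul hHc.continuousOn) hint
  have hav : ∀ z ∈ ringDomain n r, (2 * Real.pi)⁻¹ • ∫ θ in 0..2 * Real.pi,
      f (axisRotation e he (Complex.exp (θ * Complex.I)) (hnorm θ) z) *
        conj (inner ℂ e (axisRotation e he (Complex.exp (θ * Complex.I)) (hnorm θ) z) : ℂ) ^ k =
      g (inner ℂ e z) * conj (inner ℂ e z : ℂ) ^ k := by
    intro z hz
    have hin : ∀ θ : ℝ,
        (inner ℂ e (axisRotation e he (Complex.exp (θ * Complex.I)) (hnorm θ) z) : ℂ) =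
          inner ℂ e z := by
      intro θ
      change (inner ℂ e (inner ℂ e z • e +
        Complex.exp (θ * Complex.I) • (z - inner ℂ e z • e)) : ℂ) = _
      rw [inner_add_right, inner_smul_right, inner_smul_right, hperp, hee, mul_zero, mul_one,
        add_zero]
    simp only [hin]
    rw [intervalIntegral.integral_mul_const, ← smul_mul_assoc]
    congr 1
    exact hgf _ _ (hperp z) (by rwa [add_sub_cancel])
  -- Nothing bounds g near the unit circle; integrability is inherited from the averaged function.
  have hint₂ : IntegrableOn (fun z => g (inner ℂ e z) * conj (inner ℂ e z : ℂ) ^ k)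
      (ringDomain n r) := hint'.congr_fun hav hΩ
  rw [← heq, setIntegral_congr_fun hΩ hav]
  have hgc : ContinuousOn (fun z : Cn n => g (inner ℂ e z) * conj (inner ℂ e z : ℂ) ^ k)
      (ringDomain n r) := by
    refine ContinuousOn.mul ?_ hHc.continuousOn
    exact hg.continuousOn.comp (Continuous.continuousOn (by fun_prop))
      fun z hz => mem_ball_zero_iff.2 (norm_inner_lt_one he hz)
  -- Second average: scalar rotations turn ⟨e,z⟩ through a full circle and isolate the k-th Taylor
  -- coefficient.
  obtain ⟨-, heq₂⟩ := setIntegral_average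
    (fun θ => scalarRotation (Complex.exp (θ * Complex.I)) (hnorm θ))
    (by
      change Continuous fun x : Cn n × ℝ => Complex.exp (x.2 * Complex.I) • x.1
      fun_prop) hgc hint₂
  rw [← heq₂, ringMoment, ← integral_complex_ofReal, ← integral_const_mul]
  refine setIntegral_congr_fun hΩ fun z hz => ?_
  rw [← average_mul_conj_pow hg k (norm_inner_lt_one he hz)]
  congr 1
  refine intervalIntegral.integral_congr fun θ _ => ?_
  have hin : (inner ℂ e (scalarRotation (Complex.exp (θ * Complex.I)) (hnorm θ) z) : ℂ) =
      Complex.exp (θ * Complex.I) * inner ℂ e z := inner_smul_right _ _ _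
  simp only [hin]

/-- The isometry between the lines ℂe and ℂe' extends to the whole space, by finite dimensionality.
-/
theorem exists_linearIsometry_apply_eq {n : ℕ} {e e' : Cn n} (he : ‖e‖ = 1) (he' : ‖e'‖ = 1) :
    ∃ T : Cn n →ₗᵢ[ℂ] Cn n, T e = e' := by
  let L : Submodule.span ℂ {e} →ₗᵢ[ℂ] Cn n :=
    (LinearIsometry.toSpanSingleton ℂ (Cn n) he').comp
      (LinearIsometryEquiv.toSpanUnitSingleton e he).symm.toLinearIsometry
  refine ⟨L.extend, ?_⟩
  have h := L.extend_apply (LinearIsometryEquiv.toSpanUnitSingleton e he 1)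
  have h1 : ((LinearIsometryEquiv.toSpanUnitSingleton e he 1 : Submodule.span ℂ {e}) : Cn n) = e :=
    by simp
  rw [h1] at h
  rw [h]
  change LinearIsometry.toSpanSingleton ℂ (Cn n) he' ((LinearIsometryEquiv.toSpanUnitSingleton e
    he).symm (LinearIsometryEquiv.toSpanUnitSingleton e he 1)) = e'
  rw [LinearIsometryEquiv.symm_apply_apply]
  simp

/-- Unitary invariance; thanks to it the coefficients for one fixed direction serve every w. -/
theorem ringMoment_eq_ringMoment {n : ℕ} (r : ℝ) {e e' : Cn n} (he : ‖e‖ = 1) (he' : ‖e'‖ = 1)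
    (k : ℕ) : ringMoment r e k = ringMoment r e' k := by
  obtain ⟨T, hT⟩ := exists_linearIsometry_apply_eq he he'
  have h := setIntegral_comp_linearIsometry r T (fun z => ‖(inner ℂ e' z : ℂ)‖ ^ (2 * k))
  rw [← hT] at h ⊢
  simp only [T.inner_map_map] at h
  exact h

theorem integrableOn_norm_inner_pow {n : ℕ} (r : ℝ) (e : Cn n) (k : ℕ) :
    IntegrableOn (fun z : Cn n => ‖(inner ℂ e z : ℂ)‖ ^ (2 * k)) (ringDomain n r) := by
  refine IntegrableOn.mono_set (t := Metric.closedBall (0 : Cn n) 1) ?_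
    fun z hz => mem_closedBall_zero_iff.2 hz.2.le
  exact ContinuousOn.integrableOn_compact (isCompact_closedBall _ _)
    (Continuous.continuousOn (by fun_prop))

/-- V is the volume of the nonempty open part of the ring where |⟨e,z⟩| > s. Letting s approach 1
shows that ∑ t^k / m_k converges for 0 ≤ t < 1. -/
theorem exists_pos_mul_pow_le_ringMoment {n : ℕ} {r : ℝ} (hr : r < 1) {e : Cn n} (he : ‖e‖ = 1)
    {s : ℝ} (hs0 : 0 ≤ s) (hs1 : s < 1) :
    ∃ V : ℝ, 0 < V ∧ ∀ k : ℕ, V * s ^ (2 * k) ≤ ringMoment r e k := by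
  set A : Set (Cn n) := ringDomain n r ∩ {z | s < ‖(inner ℂ e z : ℂ)‖} with hA
  have hAo : IsOpen A :=
    (isOpen_ringDomain n r).inter (isOpen_lt (by fun_prop) (by fun_prop))
  have hAne : A.Nonempty := by
    obtain ⟨t, ht1, ht2⟩ := exists_between (max_lt hr hs1)
    have hst : s < t := (le_max_right _ _).trans_lt ht1
    have ht0 : 0 ≤ t := hs0.trans hst.le
    have htn : ‖(t : ℂ)‖ = t := by rw [Complex.norm_real, Real.norm_of_nonneg ht0]
    refine ⟨(t : ℂ) • e, ⟨?_, ?_⟩, ?_⟩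
    · rw [norm_smul, he, htn, mul_one]; exact (le_max_left _ _).trans_lt ht1
    · rw [norm_smul, he, htn, mul_one]; exact ht2
    · change s < ‖(inner ℂ e ((t : ℂ) • e) : ℂ)‖
      rw [inner_smul_right, inner_self_eq_norm_sq_to_K, he]
      simpa [abs_of_nonneg ht0] using hst
  have hAfin : volume A ≠ ⊤ :=
    ((measure_mono Set.inter_subset_left).trans_lt (volume_ringDomain_lt_top n r)).ne
  refine ⟨volume.real A, ENNReal.toReal_pos (hAo.measure_pos volume hAne).ne' hAfin, fun k => ?_⟩
  have hint := integrableOn_norm_inner_pow r e k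
  calc volume.real A * s ^ (2 * k) = ∫ _z in A, s ^ (2 * k) := by
        rw [setIntegral_const, smul_eq_mul]
    _ ≤ ∫ z in A, ‖(inner ℂ e z : ℂ)‖ ^ (2 * k) := by
        refine setIntegral_mono_on (integrableOn_const hAfin)
          (hint.mono_set Set.inter_subset_left) hAo.measurableSet fun z hz => ?_
        have := hz.2
        rw [Set.mem_ofPred_eq] at this
        gcongr
    _ ≤ ringMoment r e k := setIntegral_mono_set hint
        (Filter.Eventually.of_forall fun z => by positivity)
        (Set.inter_subset_left.eventuallyLE)

theorem ringMoment_pos {n : ℕ} {r : ℝ} (hr : r < 1) {e : Cn n} (he : ‖e‖ = 1) (k : ℕ) :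
    0 < ringMoment r e k := by
  obtain ⟨V, hV, h⟩ := exists_pos_mul_pow_le_ringMoment hr he (s := 1 / 2)
    (by norm_num) (by norm_num)
  exact lt_of_lt_of_le (by positivity) (h k)

theorem summable_inv_ringMoment_mul_pow {n : ℕ} {r : ℝ} (hr : r < 1) {e : Cn n} (he : ‖e‖ = 1)
    {t : ℝ} (ht0 : 0 ≤ t) (ht1 : t < 1) :
    Summable fun k : ℕ => (ringMoment r e k)⁻¹ * t ^ k := by
  -- With s = √q the lower bound reads V q^k ≤ m_k, giving comparison with a geometric series of
  -- ratio t/q < 1.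
  obtain ⟨q, hq1, hq2⟩ := exists_between ht1
  have hq0 : 0 < q := ht0.trans_lt hq1
  obtain ⟨V, hV, h⟩ := exists_pos_mul_pow_le_ringMoment hr he (s := √q) (Real.sqrt_nonneg _)
    ((Real.sqrt_lt' one_pos).2 (by simpa using hq2))
  have hsum : Summable fun k : ℕ => V⁻¹ * (t / q) ^ k :=
    (summable_geometric_of_lt_one (by positivity) ((div_lt_one hq0).2 hq1)).mul_left _
  refine Summable.of_nonneg_of_le
    (fun k => mul_nonneg (inv_nonneg.2 (ringMoment_pos hr he k).le) (by positivity))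
    (fun k => ?_) hsum
  have hk := h k
  rw [pow_mul, Real.sq_sqrt hq0.le] at hk
  calc (ringMoment r e k)⁻¹ * t ^ k ≤ (V * q ^ k)⁻¹ * t ^ k := by gcongr
    _ = V⁻¹ * (t / q) ^ k := by rw [div_pow]; field_simp

/-- Inner radius -1 is no constraint (radius 0 would remove the origin), so every statement assuming
only r < 1 covers ring and ball at once. -/
theorem ringDomain_neg_one (n : ℕ) : ringDomain n (-1) = Metric.ball 0 1 := by
  ext z
  rw [mem_ball_zero_iff]
  exact ⟨fun h => h.2, fun h => ⟨by linarith [norm_nonneg z], h⟩⟩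

theorem unitBall_eq_ringDomain (n : ℕ) : unitBall n = ringDomain n (-1) := by
  rw [ringDomain_neg_one]
  ext z
  rw [mem_ball_zero_iff]
  rfl

/-- Scaling relates the moments of a ring domain and of the unit ball. -/
theorem ringMoment_eq_mul_ballMoment {n : ℕ} {r : ℝ} (hr0 : 0 < r) (hr1 : r < 1) (e : Cn n)
    (k : ℕ) : ringMoment r e k = (1 - r ^ (2 * (n + k))) * ringMoment (-1) e k := by
  set φ : Cn n → ℝ := fun z => ‖(inner ℂ e z : ℂ)‖ ^ (2 * k) with hφ
  have hφc : Continuous φ := by fun_prop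
  have hint : ∀ R : ℝ, IntegrableOn φ (Metric.closedBall 0 R) := fun R =>
    ContinuousOn.integrableOn_compact (isCompact_closedBall _ _) hφc.continuousOn
  have h1 : ∫ z in Metric.ball (0 : Cn n) 1, φ z =
      (∫ z in ringDomain n r, φ z) + ∫ z in Metric.closedBall (0 : Cn n) r, φ z := by
    rw [← setIntegral_union _ Metric.isClosed_closedBall.measurableSet
      (integrableOn_norm_inner_pow r e k) (hint r)]
    · congr 2
      ext z
      simp only [mem_ball_zero_iff, Set.mem_union, mem_closedBall_zero_iff]
      constructor
      · intro h
        rcases le_or_gt ‖z‖ r with h' | h'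
        · exact Or.inr h'
        · exact Or.inl ⟨h', h⟩
      · rintro (h | h)
        · exact h.2
        · exact h.trans_lt hr1
    · rw [Set.disjoint_left]
      intro z hz hz'
      rw [mem_closedBall_zero_iff] at hz'
      exact absurd hz.1 (not_lt.2 hz')
  -- The factor r^{2n} is the Jacobian in real dimension 2n, and r^{2k} comes from the homogeneity
  -- of the integrand.
  have h2 : ∫ z in Metric.closedBall (0 : Cn n) r, φ z =
      r ^ (2 * (n + k)) * ∫ z in Metric.closedBall (0 : Cn n) 1, φ z := by
    have h := Measure.setIntegral_comp_smul (volume : Measure (Cn n)) φ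
      (Metric.closedBall (0 : Cn n) 1) hr0.ne'
    have hfin : Module.finrank ℝ (Cn n) = 2 * n := by
      rw [finrank_real_of_complex, finrank_euclideanSpace, Fintype.card_fin]
    rw [smul_unitClosedBall_of_nonneg hr0.le, hfin, abs_of_nonneg (by positivity),
      smul_eq_mul] at h
    have hsc : ∀ z : Cn n, φ (r • z) = r ^ (2 * k) * φ z := fun z => by
      have : r • z = (r : ℂ) • z := (Complex.coe_smul r z).symm
      simp only [hφ]
      rw [this, inner_smul_right, norm_mul, Complex.norm_real, Real.norm_of_nonneg hr0.le, mul_pow]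
    simp only [hsc] at h
    rw [integral_const_mul] at h
    rw [mul_add, pow_add, mul_assoc, h, ← mul_assoc,
      mul_inv_cancel₀ (pow_pos hr0 _).ne', one_mul]
  have h3 : ∫ z in Metric.closedBall (0 : Cn n) 1, φ z = ∫ z in Metric.ball (0 : Cn n) 1, φ z := by
    refine setIntegral_congr_set ?_
    rw [← Metric.ball_union_sphere]
    exact union_ae_eq_left_of_ae_eq_empty
      (ae_eq_empty.2 (Measure.addHaar_sphere_of_ne_zero _ _ one_ne_zero))
  rw [ringMoment, ringMoment, ringDomain_neg_one]
  rw [h2, h3] at h1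
  change ∫ z in ringDomain n r, φ z = (1 - r ^ (2 * (n + k))) * ∫ z in Metric.ball (0 : Cn n) 1, φ z
  linarith

/-! ### Power series with nonnegative coefficients -/

/-- The sum of the power series with real coefficients `c`. -/
noncomputable def powerSum (c : ℕ → ℝ) (x : ℂ) : ℂ := ∑' k, (c k : ℂ) * x ^ k

section PowerSum

variable {c : ℕ → ℝ}

theorem norm_coeff_mul_pow_le (hc : ∀ k, 0 ≤ c k) {x : ℂ} {t : ℝ} (hx : ‖x‖ ≤ t) (k : ℕ) :
    ‖(c k : ℂ) * x ^ k‖ ≤ c k * t ^ k := by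
  rw [norm_mul, Complex.norm_real, Real.norm_of_nonneg (hc k), norm_pow]
  have := hc k
  gcongr

theorem differentiableOn_powerSum (hc : ∀ k, 0 ≤ c k)
    (hs : ∀ t : ℝ, 0 ≤ t → t < 1 → Summable fun k => c k * t ^ k) :
    DifferentiableOn ℂ (powerSum c) (Metric.ball 0 1) := by
  intro x hx
  obtain ⟨t, ht1, ht2⟩ := exists_between (mem_ball_zero_iff.1 hx)
  have h := Complex.differentiableOn_tsum_of_summable_norm (U := Metric.ball 0 t)
    (F := fun k x => (c k : ℂ) * x ^ k) (hs t ((norm_nonneg x).trans ht1.le) ht2)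
    (fun k => by fun_prop) Metric.isOpen_ball
    (fun k w hw => norm_coeff_mul_pow_le hc (mem_ball_zero_iff.1 hw).le k)
  exact (h.differentiableAt (Metric.isOpen_ball.mem_nhds
    (mem_ball_zero_iff.2 ht1))).differentiableWithinAt

theorem norm_powerSum_le (hc : ∀ k, 0 ≤ c k) {x : ℂ} {t : ℝ}
    (hs : Summable fun k => c k * t ^ k) (hx : ‖x‖ ≤ t) :
    ‖powerSum c x‖ ≤ ∑' k, c k * t ^ k :=
  tsum_of_norm_bounded hs.hasSum (norm_coeff_mul_pow_le hc hx)

theorem powerSum_ofReal (t : ℝ) : powerSum c t = ((∑' k, c k * t ^ k : ℝ) : ℂ) := by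
  rw [powerSum, Complex.ofReal_tsum]
  push_cast
  rfl

theorem hasSum_deriv_powerSum (hc : ∀ k, 0 ≤ c k)
    (hs : ∀ t : ℝ, 0 ≤ t → t < 1 → Summable fun k => c k * t ^ k) {x : ℂ} (hx : ‖x‖ < 1) :
    HasSum (fun k : ℕ => (c k : ℂ) * (k * x ^ (k - 1))) (deriv (powerSum c) x) := by
  obtain ⟨t, ht1, ht2⟩ := exists_between hx
  have h := Complex.hasSum_deriv_of_summable_norm (U := Metric.ball 0 t)
    (F := fun k x => (c k : ℂ) * x ^ k) (hs t ((norm_nonneg x).trans ht1.le) ht2)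
    (fun k => by fun_prop) Metric.isOpen_ball
    (fun k w hw => norm_coeff_mul_pow_le hc (mem_ball_zero_iff.1 hw).le k)
    (mem_ball_zero_iff.2 ht1)
  have hk : (fun k : ℕ => (c k : ℂ) * (k * x ^ (k - 1))) =
      fun k => deriv (fun x => (c k : ℂ) * x ^ k) x := by
    funext k
    rw [deriv_const_mul _ (by fun_prop), deriv_pow_field]
  rw [hk]
  exact h

/-- The derivative of the real power series `∑ cₖ tᵏ`, as a series. -/
theorem hasSum_deriv_tsum (hc : ∀ k, 0 ≤ c k)
    (hs : ∀ t : ℝ, 0 ≤ t → t < 1 → Summable fun k => c k * t ^ k) {t : ℝ} (ht : |t| < 1) :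
    HasSum (fun k : ℕ => c k * (k * t ^ (k - 1))) (deriv (fun t => ∑' k, c k * t ^ k) t) := by
  have hx : ‖(t : ℂ)‖ < 1 := by rwa [Complex.norm_real]
  have h1 := (((differentiableOn_powerSum hc hs).differentiableAt
    (Metric.isOpen_ball.mem_nhds (mem_ball_zero_iff.2 hx))).hasDerivAt).real_of_complex
  have h2 := Complex.hasSum_re (hasSum_deriv_powerSum hc hs hx)
  simp only [powerSum_ofReal, Complex.ofReal_re] at h1
  rw [h1.deriv]
  convert h2 using 2 with k
  rw [← Complex.ofReal_pow, ← Complex.ofReal_natCast, ← Complex.ofReal_mul, ← Complex.ofReal_mul,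
    Complex.ofReal_re]

/-- Smoothness is inherited from the holomorphic sum on the disc. The interval extends below 0 so
that t = 0, the centre of the ball, is interior. -/
theorem contDiffOn_tsum (hc : ∀ k, 0 ≤ c k)
    (hs : ∀ t : ℝ, 0 ≤ t → t < 1 → Summable fun k => c k * t ^ k) :
    ContDiffOn ℝ 2 (fun t : ℝ => ∑' k, c k * t ^ k) (Set.Ioo (-1) 1) := by
  have h1 : ContDiffOn ℝ 2 (powerSum c) (Metric.ball 0 1) :=
    ((differentiableOn_powerSum hc hs).contDiffOn Metric.isOpen_ball).restrict_scalars ℝ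
  have h2 : ContDiffOn ℝ 2 (fun t : ℝ => (powerSum c t).re) (Set.Ioo (-1) 1) := by
    refine Complex.reCLM.contDiff.comp_contDiffOn
      (h1.comp (Complex.ofRealCLM.contDiff.contDiffOn) ?_)
    intro t ht
    rw [mem_ball_zero_iff]
    change ‖(t : ℂ)‖ < 1
    rw [Complex.norm_real]
    exact abs_lt.2 ht
  simpa only [powerSum_ofReal, Complex.ofReal_re] using h2

end PowerSum

/-! ### The Bergman kernel as a series -/

theorem memLp_two_integrableOn {n : ℕ} {r : ℝ} {f : Cn n → ℂ}
    (hf : MemLp f 2 (volume.restrict (ringDomain n r))) : IntegrableOn f (ringDomain n r) := by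
  have : IsFiniteMeasure (volume.restrict (ringDomain n r)) :=
    ⟨by rw [Measure.restrict_apply_univ]; exact volume_ringDomain_lt_top n r⟩
  exact hf.integrable one_le_two

/-- The Bergman kernel of a ring domain, as a power series in `⟨w, z⟩`. -/
theorem isReproducingAt_powerSum {n : ℕ} {r : ℝ} (hr : r < 1) {e₀ : Cn n} (he₀ : ‖e₀‖ = 1)
    (hperp : ∀ e : Cn n, ‖e‖ = 1 → ∃ u : Cn n, ‖u‖ = 1 ∧ inner ℂ e u = 0)
    {w : Cn n} (hw : w ∈ ringDomain n r) :
    IsReproducingAt (ringDomain n r) w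
      (fun z => powerSum (fun k => (ringMoment r e₀ k)⁻¹) (inner ℂ w z)) := by
  set c : ℕ → ℝ := fun k => (ringMoment r e₀ k)⁻¹ with hc_def
  have hc : ∀ k, 0 ≤ c k := fun k => (inv_pos.2 (ringMoment_pos hr he₀ k)).le
  have hs : ∀ t : ℝ, 0 ≤ t → t < 1 → Summable fun k => c k * t ^ k := fun t h0 h1 =>
    summable_inv_ringMoment_mul_pow hr he₀ h0 h1
  have hin : ∀ z ∈ ringDomain n r, ‖(inner ℂ w z : ℂ)‖ ≤ ‖w‖ := fun z hz =>
    (norm_inner_le_norm w z).trans (mul_le_of_le_one_right (norm_nonneg _) hz.2.le)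
  have hd : DifferentiableOn ℂ (fun z : Cn n => powerSum c (inner ℂ w z)) (ringDomain n r) := by
    refine (differentiableOn_powerSum hc hs).comp (f := fun z : Cn n => (inner ℂ w z : ℂ))
      (innerSL ℂ w).differentiable.differentiableOn fun z hz => ?_
    exact mem_ball_zero_iff.2 ((hin z hz).trans_lt hw.2)
  have hΩ := (isOpen_ringDomain n r).measurableSet
  have : IsFiniteMeasure (volume.restrict (ringDomain n r)) :=
    ⟨by rw [Measure.restrict_apply_univ]; exact volume_ringDomain_lt_top n r⟩
  refine ⟨⟨hd, MemLp.of_bound (hd.continuousOn.aestronglyMeasurable hΩ) (∑' k, c k * ‖w‖ ^ k) ?_⟩,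
    fun f hf => ?_⟩
  · filter_upwards [ae_restrict_mem hΩ] with z hz
    exact norm_powerSum_le hc (hs _ (norm_nonneg _) hw.2) (hin z hz)
  -- For w = 0, which occurs in the ball, any axis will do.
  obtain ⟨e, he, hwe⟩ : ∃ e : Cn n, ‖e‖ = 1 ∧ w = (‖w‖ : ℂ) • e := by
    rcases eq_or_ne w 0 with rfl | hw0
    · exact ⟨e₀, he₀, by simp⟩
    · have hwn : (‖w‖ : ℂ) ≠ 0 := by simpa using hw0
      refine ⟨((‖w‖ : ℂ)⁻¹) • w, ?_, ?_⟩
      · rw [norm_smul, norm_inv, Complex.norm_real, norm_norm,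
          inv_mul_cancel₀ (norm_ne_zero_iff.2 hw0)]
      · rw [smul_smul, mul_inv_cancel₀ hwn, one_smul]
  -- Dimension at least two enters here: a direction transverse to e is what makes the averages
  -- extend across the hole.
  obtain ⟨u, hu, heu⟩ := hperp e he
  have hfi := memLp_two_integrableOn hf.2
  obtain ⟨g, hg, hgf, hgm⟩ := exists_moments hr he hu heu hf.1 hfi
  have hinner : ∀ z : Cn n, (inner ℂ w z : ℂ) = ‖w‖ * inner ℂ e z := fun z => by
    conv_lhs => rw [hwe]
    rw [inner_smul_left, Complex.conj_ofReal]
  set F : ℕ → Cn n → ℂ := fun k z =>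
    ((c k * ‖w‖ ^ k : ℝ) : ℂ) * (f z * conj (inner ℂ e z : ℂ) ^ k) with hF
  have hFint : ∀ k, IntegrableOn (F k) (ringDomain n r) := fun k => by
    refine Integrable.const_mul ?_ _
    refine integrableOn_mul_bounded hfi (by fun_prop) (C := 1) fun z hz => ?_
    rw [norm_pow, RCLike.norm_conj]
    exact pow_le_one₀ (norm_nonneg _) (norm_inner_lt_one he hz).le
  have hFle : ∀ k, ∫ z in ringDomain n r, ‖F k z‖ ≤
      c k * ‖w‖ ^ k * ∫ z in ringDomain n r, ‖f z‖ := fun k => by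
    rw [← integral_const_mul]
    refine setIntegral_mono_on (hFint k).norm (hfi.norm.const_mul _) hΩ fun z hz => ?_
    have h0 : 0 ≤ c k * ‖w‖ ^ k := mul_nonneg (hc k) (by positivity)
    rw [hF, norm_mul, Complex.norm_real, Real.norm_of_nonneg h0, norm_mul, norm_pow,
      RCLike.norm_conj]
    exact mul_le_mul_of_nonneg_left (mul_le_of_le_one_right (norm_nonneg _)
      (pow_le_one₀ (norm_nonneg _) (norm_inner_lt_one he hz).le)) h0
  -- Termwise integration is allowed because the L¹ norms are dominated by c_k ‖w‖^k ‖f‖₁.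
  have hsum := hasSum_integral_of_summable_integral_norm hFint
    (Summable.of_nonneg_of_le (fun k => integral_nonneg fun z => norm_nonneg _) hFle
      ((hs _ (norm_nonneg _) hw.2).mul_right _))
  -- The coefficient 1/m_k cancels the moment, leaving the k-th Taylor term of g at ‖w‖.
  have hterm : ∀ k, ∫ z in ringDomain n r, F k z =
      (k.factorial : ℂ)⁻¹ • ((‖w‖ : ℂ) - 0) ^ k • iteratedDeriv k g 0 := fun k => by
    rw [hF, integral_const_mul, hgm k, ringMoment_eq_ringMoment r he he₀ k]
    have hm : (ringMoment r e₀ k : ℂ) ≠ 0 := by exact_mod_cast (ringMoment_pos hr he₀ k).ne'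
    simp only [hc_def, smul_eq_mul, sub_zero]
    push_cast
    field_simp
  have htsum : ∀ z, ∑' k, F k z = f z * conj (powerSum c (inner ℂ w z)) := fun z => by
    rw [powerSum, Complex.conj_tsum, ← tsum_mul_left]
    refine tsum_congr fun k => ?_
    rw [hF, hinner z]
    simp only [map_mul, map_pow, Complex.conj_ofReal]
    push_cast
    ring
  simp only [hterm, htsum] at hsum
  have hwn : ‖(‖w‖ : ℂ)‖ = ‖w‖ := by rw [Complex.norm_real, norm_norm]
  have htaylor := Complex.hasSum_taylorSeries_on_ball (f := g) (c := 0) (r := 1) (by simpa using hg)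
    (z := (‖w‖ : ℂ)) (by simpa [hwn] using hw.2)
  have hfw : f w = g ‖w‖ := by
    rw [hgf _ (by rwa [← hwe]), ← hwe]
  rw [hfw]
  exact htaylor.unique hsum

/-- Reproducing elements are unique: on the diagonal the Bergman kernel is given by any family of
reproducing elements. -/
theorem bergmanKernel_diag_eq {n : ℕ} {Ω : Set (Cn n)} {κ : Cn n → Cn n → ℂ}
    {w : Cn n} (hw : IsReproducingAt Ω w (κ w)) : bergmanKernel Ω w w = conj (κ w w) := by
  have hex : ∃ k : Cn n → ℂ, IsReproducingAt Ω w k := ⟨κ w, hw⟩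
  rw [bergmanKernel, dif_pos hex]
  have hk := hex.choose_spec
  -- Tested against each other, two reproducing elements k and κ at w satisfy k(w) = conj κ(w).
  rw [hw.2 _ hk.1, hk.2 _ hw.1, ← integral_conj]
  refine integral_congr_ae (Filter.Eventually.of_forall fun z => ?_)
  simp only [map_mul, Complex.conj_conj, mul_comm]

/-! ### Levi forms of radial functions -/

section Wirtinger

variable {n : ℕ}

theorem norm_sq_eq_inner_re (z : Cn n) : (inner ℂ z z : ℂ) = ((‖z‖ ^ 2 : ℝ) : ℂ) := by
  rw [inner_self_eq_norm_sq_to_K]; push_cast; rfl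

theorem hasFDerivAt_ofReal_comp_norm_sq {ψ : ℝ → ℝ} {z : Cn n}
    (hψ : DifferentiableAt ℝ ψ (‖z‖ ^ 2)) :
    HasFDerivAt (fun z : Cn n => ((ψ (‖z‖ ^ 2) : ℝ) : ℂ))
      (Complex.ofRealCLM.comp (deriv ψ (‖z‖ ^ 2) • (2 • innerSL ℝ z))) z := by
  have h1 : HasFDerivAt (fun z : Cn n => ‖z‖ ^ 2) (2 • innerSL ℝ z) z :=
    (hasStrictFDerivAt_norm_sq z).hasFDerivAt
  exact Complex.ofRealCLM.hasFDerivAt.comp z (hψ.hasDerivAt.comp_hasFDerivAt z h1)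

theorem real_inner_single (z : Cn n) (ν : Fin n) (a : ℂ) :
    (inner ℝ z (EuclideanSpace.single ν a) : ℝ) = (conj (z ν) * a).re := by
  rw [PiLp.inner_apply, Finset.sum_eq_single ν]
  · simp [Complex.inner, mul_comm]
  · intro i _ hi
    simp [hi]
  · simp

theorem dzbar_ofReal_comp_norm_sq {ψ : ℝ → ℝ} {z : Cn n}
    (hψ : DifferentiableAt ℝ ψ (‖z‖ ^ 2)) (μ : Fin n) :
    dzbar μ (fun z : Cn n => ((ψ (‖z‖ ^ 2) : ℝ) : ℂ)) z = deriv ψ (‖z‖ ^ 2) * z μ := by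
  rw [dzbar, (hasFDerivAt_ofReal_comp_norm_sq hψ).fderiv]
  simp only [ContinuousLinearMap.comp_apply, smul_apply, innerSL_apply_apply,
    real_inner_single, Complex.ofRealCLM_apply]
  apply Complex.ext <;> simp <;> ring

theorem dz_ofReal_comp_norm_sq {ψ : ℝ → ℝ} {z : Cn n}
    (hψ : DifferentiableAt ℝ ψ (‖z‖ ^ 2)) (μ : Fin n) :
    dz μ (fun z : Cn n => ((ψ (‖z‖ ^ 2) : ℝ) : ℂ)) z = deriv ψ (‖z‖ ^ 2) * conj (z μ) := by
  rw [dz, (hasFDerivAt_ofReal_comp_norm_sq hψ).fderiv]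
  simp only [ContinuousLinearMap.comp_apply, smul_apply, innerSL_apply_apply,
    real_inner_single, Complex.ofRealCLM_apply]
  apply Complex.ext <;> simp <;> ring

theorem dz_mul_coord {h : Cn n → ℂ} {z : Cn n} (hh : DifferentiableAt ℝ h z) (ν μ : Fin n) :
    dz ν (fun z => h z * z μ) z = dz ν h z * z μ + h z * (if ν = μ then 1 else 0) := by
  have h1 : HasFDerivAt (fun z : Cn n => z μ)
      ((EuclideanSpace.proj (𝕜 := ℂ) μ : Cn n →L[ℂ] ℂ).restrictScalars ℝ) z :=
    ((EuclideanSpace.proj (𝕜 := ℂ) μ : Cn n →L[ℂ] ℂ).restrictScalars ℝ).hasFDerivAt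
  have h2 : fderiv ℝ (fun z => h z * z μ) z =
      h z • (EuclideanSpace.proj (𝕜 := ℂ) μ : Cn n →L[ℂ] ℂ).restrictScalars ℝ +
        z μ • fderiv ℝ h z := (hh.hasFDerivAt.mul h1).fderiv
  rw [dz, dz, h2]
  by_cases hνμ : ν = μ
  · subst hνμ
    simp
    linear_combination (-h z / 2) * Complex.I_mul_I
  · simp [hνμ, Ne.symm hνμ]
    ring

/-- The rank-one part factors through the vanishing product of x and y. This is why ψ'' drops out of
the Levi form in tangential directions. -/
theorem sum_sum_tangential (a b : ℂ) (x y : Fin n → ℂ) (h : ∑ i, x i * conj (y i) = 0) :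
    ∑ ν, ∑ μ, (a * conj (y ν) * y μ + b * (if ν = μ then 1 else 0)) * x ν * conj (x μ) =
      b * ∑ ν, x ν * conj (x ν) := by
  calc ∑ ν, ∑ μ, (a * conj (y ν) * y μ + b * (if ν = μ then 1 else 0)) * x ν * conj (x μ)
      = a * ((∑ ν, x ν * conj (y ν)) * ∑ μ, y μ * conj (x μ)) + b * ∑ ν, x ν * conj (x ν) := by
        rw [Finset.sum_mul_sum, Finset.mul_sum, Finset.mul_sum, ← Finset.sum_add_distrib]
        refine Finset.sum_congr rfl fun ν _ => ?_
        simp only [add_mul, Finset.sum_add_distrib, Finset.mul_sum]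
        congr 1
        · exact Finset.sum_congr rfl fun μ _ => by ring
        · simp
          ring
    _ = b * ∑ ν, x ν * conj (x ν) := by rw [h, zero_mul, mul_zero, zero_add]

/-- The Levi form of a radial function `ψ(|z|²)` in a direction tangential to the sphere. -/
theorem leviForm_comp_norm_sq {ψ : ℝ → ℝ} {u : Cn n → ℝ} {p ξ : Cn n}
    (hψ : ContDiffAt ℝ 2 ψ (‖p‖ ^ 2)) (hu : ∀ᶠ z in nhds p, u z = ψ (‖z‖ ^ 2))
    (htan : ∑ i, ξ i * conj (p i) = 0) :
    leviForm u p ξ = ((deriv ψ (‖p‖ ^ 2) * ‖ξ‖ ^ 2 : ℝ) : ℂ) := by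
  have hc : Filter.Tendsto (fun z : Cn n => ‖z‖ ^ 2) (nhds p) (nhds (‖p‖ ^ 2)) :=
    (by fun_prop : Continuous fun z : Cn n => ‖z‖ ^ 2).tendsto p
  have hψ' : ContDiffAt ℝ 1 (deriv ψ) (‖p‖ ^ 2) := by
    have h := (hψ.fderiv_right (m := 1) (by norm_num)).clm_apply
      (contDiffAt_const (c := (1 : ℝ)))
    simpa only [fderiv_apply_one_eq_deriv] using h
  have hdiff : ∀ᶠ z : Cn n in nhds p, DifferentiableAt ℝ ψ (‖z‖ ^ 2) :=
    hc.eventually ((hψ.eventually (by simp)).mono fun t ht => ht.differentiableAt (by simp))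
  have hd' : DifferentiableAt ℝ (deriv ψ) (‖p‖ ^ 2) := hψ'.differentiableAt (by simp)
  have hterm : ∀ ν μ : Fin n, dz ν (dzbar μ fun z => (u z : ℂ)) p =
      deriv (deriv ψ) (‖p‖ ^ 2) * conj (p ν) * p μ +
        deriv ψ (‖p‖ ^ 2) * (if ν = μ then 1 else 0) := by
    intro ν μ
    have h1 : (dzbar μ fun z => (u z : ℂ)) =ᶠ[nhds p]
        fun z => ((deriv ψ (‖z‖ ^ 2) : ℝ) : ℂ) * z μ := by
      filter_upwards [hu.eventually_nhds, hdiff] with z hz hz'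
      rw [← dzbar_ofReal_comp_norm_sq hz' μ, dzbar, dzbar]
      have : (fun z => (u z : ℂ)) =ᶠ[nhds z] fun z => ((ψ (‖z‖ ^ 2) : ℝ) : ℂ) :=
        hz.mono fun y hy => by simp only [hy]
      rw [this.fderiv_eq]
    rw [← dz_ofReal_comp_norm_sq hd' ν,
      ← dz_mul_coord (hasFDerivAt_ofReal_comp_norm_sq hd').differentiableAt]
    rw [dz, dz, h1.fderiv_eq]
  rw [leviForm]
  simp only [hterm]
  have hξ : ((‖ξ‖ ^ 2 : ℝ) : ℂ) = ∑ ν, ξ ν * conj (ξ ν) := by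
    rw [EuclideanSpace.norm_sq_eq]
    push_cast
    exact Finset.sum_congr rfl fun ν _ => (Complex.mul_conj' _).symm
  have h := sum_sum_tangential ((deriv (deriv ψ) (‖p‖ ^ 2) : ℝ) : ℂ)
    ((deriv ψ (‖p‖ ^ 2) : ℝ) : ℂ) (fun i => ξ i) (fun i => p i) htan
  rw [← hξ, ← Complex.ofReal_mul] at h
  exact h

end Wirtinger

/-! ### Monotone reweighting of means -/

/-- A strict Chebyshev inequality: a decreasing reweighting decreases the mean. -/
theorem tsum_mul_tsum_lt_of_strictAnti {w a : ℕ → ℝ} (hw : ∀ k, 0 < w k) (ha : StrictAnti a)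
    (hs : Summable w) (hs₁ : Summable fun k : ℕ => (k : ℝ) * w k)
    (has : Summable fun k => a k * w k) (has₁ : Summable fun k : ℕ => (k : ℝ) * (a k * w k)) :
    (∑' k : ℕ, (k : ℝ) * (a k * w k)) * ∑' k, w k < (∑' k : ℕ, (k : ℝ) * w k) * ∑' k, a k * w k := by
  have hS : 0 < ∑' k, w k := hs.tsum_pos (fun k => (hw k).le) 0 (hw 0)
  -- M is the mean of the index k under the weights w.
  set M : ℝ := (∑' k : ℕ, (k : ℝ) * w k) / ∑' k, w k with hM
  have hM0 : 0 ≤ M := div_nonneg (tsum_nonneg fun k : ℕ => mul_nonneg k.cast_nonneg (hw k).le) hS.le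
  have hMS : ∑' k : ℕ, (k : ℝ) * w k = M * ∑' k, w k := (div_mul_cancel₀ _ hS.ne').symm
  -- Since k - M changes sign just after m, and a_k - a_m changes sign there in the opposite sense,
  -- every product is at most 0; the index m + 1 gives strictness.
  set m : ℕ := ⌊M⌋₊ with hm
  have hterm : ∀ k : ℕ, ((k : ℝ) - M) * (a k - a m) * w k ≤ 0 := by
    intro k
    refine mul_nonpos_of_nonpos_of_nonneg ?_ (hw k).le
    rcases le_or_gt k m with h | h
    · have h1 : (k : ℝ) ≤ M := (Nat.le_floor_iff hM0).1 h
      exact mul_nonpos_of_nonpos_of_nonneg (sub_nonpos.2 h1) (sub_nonneg.2 (ha.antitone h))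
    · have h1 : M < k := (Nat.floor_lt hM0).1 h
      exact mul_nonpos_of_nonneg_of_nonpos (sub_nonneg.2 h1.le) (sub_nonpos.2 (ha h).le)
  have hlt : ((m + 1 : ℕ) - M) * (a (m + 1) - a m) * w (m + 1) < 0 := by
    have h1 : M < (m + 1 : ℕ) := (Nat.floor_lt hM0).1 m.lt_succ_self
    exact mul_neg_of_neg_of_pos (mul_neg_of_pos_of_neg (sub_pos.2 h1)
      (sub_neg.2 (ha m.lt_succ_self))) (hw _)
  -- The a_m part sums to zero because ∑ (k - M) w_k = 0.
  have heq : HasSum (fun k : ℕ => ((k : ℝ) - M) * (a k - a m) * w k)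
      ((∑' k : ℕ, (k : ℝ) * (a k * w k)) - M * (∑' k, a k * w k) -
        a m * ((∑' k : ℕ, (k : ℝ) * w k) - M * ∑' k, w k)) := by
    refine ((has₁.hasSum.sub (has.hasSum.mul_left M)).sub
      ((hs₁.hasSum.sub (hs.hasSum.mul_left M)).mul_left (a m))).congr_fun fun k => ?_
    ring
  have hneg : (∑' k : ℕ, (k : ℝ) * (a k * w k)) - M * (∑' k, a k * w k) < 0 := by
    have := hasSum_lt (f := fun k : ℕ => ((k : ℝ) - M) * (a k - a m) * w k) (g := fun _ => 0)
      hterm (i := m + 1) hlt heq hasSum_zero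
    rwa [hMS, sub_self, mul_zero, sub_zero] at this
  rw [hMS]
  nlinarith

/-! ### The radial kernel and its logarithmic derivative -/

/-- The Bergman kernel of a ring domain on the diagonal, as a function of `t = |z|²`. -/
noncomputable def radialKernel {n : ℕ} (r : ℝ) (e : Cn n) (t : ℝ) : ℝ :=
  ∑' k, (ringMoment r e k)⁻¹ * t ^ k

section RadialKernel

variable {n : ℕ} {r : ℝ} {e : Cn n}

theorem inv_ringMoment_nonneg (hr : r < 1) (he : ‖e‖ = 1) (k : ℕ) : 0 ≤ (ringMoment r e k)⁻¹ :=
  (inv_pos.2 (ringMoment_pos hr he k)).le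

theorem radialKernel_pos (hr : r < 1) (he : ‖e‖ = 1) {t : ℝ} (ht0 : 0 ≤ t) (ht1 : t < 1) :
    0 < radialKernel r e t :=
  (summable_inv_ringMoment_mul_pow hr he ht0 ht1).tsum_pos
    (fun k => mul_nonneg (inv_ringMoment_nonneg hr he k) (by positivity)) 0
    (by simpa using ringMoment_pos hr he 0)

theorem hasSum_deriv_radialKernel (hr : r < 1) (he : ‖e‖ = 1) {t : ℝ} (ht0 : 0 ≤ t) (ht1 : t < 1) :
    HasSum (fun k : ℕ => (ringMoment r e k)⁻¹ * (k * t ^ (k - 1))) (deriv (radialKernel r e) t) :=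
  hasSum_deriv_tsum (inv_ringMoment_nonneg hr he)
    (fun _ h0 h1 => summable_inv_ringMoment_mul_pow hr he h0 h1) (abs_lt.2 ⟨by linarith, ht1⟩)

theorem contDiffAt_radialKernel (hr : r < 1) (he : ‖e‖ = 1) {t : ℝ} (ht0 : 0 ≤ t) (ht1 : t < 1) :
    ContDiffAt ℝ 2 (radialKernel r e) t :=
  (contDiffOn_tsum (inv_ringMoment_nonneg hr he)
    (fun _ h0 h1 => summable_inv_ringMoment_mul_pow hr he h0 h1)).contDiffAt
    (Ioo_mem_nhds (by linarith) ht1)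

/-- Multiplying by t restores t^k, so that tκ'/κ becomes a weighted mean of k. -/
theorem hasSum_mul_deriv_radialKernel (hr : r < 1) (he : ‖e‖ = 1) {t : ℝ} (ht0 : 0 ≤ t)
    (ht1 : t < 1) :
    HasSum (fun k : ℕ => (k : ℝ) * ((ringMoment r e k)⁻¹ * t ^ k))
      (t * deriv (radialKernel r e) t) := by
  refine ((hasSum_deriv_radialKernel hr he ht0 ht1).mul_left t).congr_fun fun k => ?_
  rcases k with _ | k
  · simp
  · rw [Nat.add_sub_cancel, pow_succ]
    ring

theorem deriv_radialKernel_nonneg (hr : r < 1) (he : ‖e‖ = 1) {t : ℝ} (ht0 : 0 ≤ t)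
    (ht1 : t < 1) : 0 ≤ deriv (radialKernel r e) t :=
  (hasSum_deriv_radialKernel hr he ht0 ht1).nonneg fun k =>
    mul_nonneg (inv_ringMoment_nonneg hr he k) (by positivity)

theorem norm_sq_lt_one {z : Cn n} (hz : z ∈ ringDomain n r) : ‖z‖ ^ 2 < 1 :=
  pow_lt_one₀ (norm_nonneg _) hz.2 two_ne_zero

theorem bergmanKernel_ringDomain_diag (hr : r < 1) (he : ‖e‖ = 1)
    (hperp : ∀ e : Cn n, ‖e‖ = 1 → ∃ u : Cn n, ‖u‖ = 1 ∧ inner ℂ e u = 0)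
    {z : Cn n} (hz : z ∈ ringDomain n r) :
    bergmanKernel (ringDomain n r) z z = (radialKernel r e (‖z‖ ^ 2) : ℝ) := by
  rw [bergmanKernel_diag_eq (κ := fun w z => powerSum (fun k => (ringMoment r e k)⁻¹) (inner ℂ w z))
    (isReproducingAt_powerSum hr he hperp hz), norm_sq_eq_inner_re, powerSum_ofReal,
    Complex.conj_ofReal]
  rfl

theorem logKernelDiag_ringDomain (hr : r < 1) (he : ‖e‖ = 1)
    (hperp : ∀ e : Cn n, ‖e‖ = 1 → ∃ u : Cn n, ‖u‖ = 1 ∧ inner ℂ e u = 0)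
    {z : Cn n} (hz : z ∈ ringDomain n r) :
    logKernelDiag (ringDomain n r) z = Real.log (radialKernel r e (‖z‖ ^ 2)) := by
  rw [logKernelDiag, bergmanKernel_ringDomain_diag hr he hperp hz, Complex.ofReal_re]

theorem hasBergmanMetric_ringDomain (hr : r < 1) (he : ‖e‖ = 1)
    (hperp : ∀ e : Cn n, ‖e‖ = 1 → ∃ u : Cn n, ‖u‖ = 1 ∧ inner ℂ e u = 0) :
    HasBergmanMetric (ringDomain n r) := by
  refine ⟨fun w hw => ⟨_, isReproducingAt_powerSum hr he hperp hw⟩, fun z hz => ?_, ?_⟩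
  · rw [bergmanKernel_ringDomain_diag hr he hperp hz, Complex.ofReal_ne_zero]
    exact (radialKernel_pos hr he (sq_nonneg _) (norm_sq_lt_one hz)).ne'
  · refine ContDiffOn.congr ?_ fun z hz => logKernelDiag_ringDomain hr he hperp hz
    intro z hz
    refine (((contDiffAt_radialKernel hr he (sq_nonneg _) (norm_sq_lt_one hz)).log
      (radialKernel_pos hr he (sq_nonneg _) (norm_sq_lt_one hz)).ne').comp z
      (contDiff_norm_sq ℝ).contDiffAt).contDiffWithinAt

/-- The Bergman metric of a ring domain in tangential directions. -/
theorem bergmanMetric_ringDomain_of_tangential (hr : r < 1) (he : ‖e‖ = 1)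
    (hperp : ∀ e : Cn n, ‖e‖ = 1 → ∃ u : Cn n, ‖u‖ = 1 ∧ inner ℂ e u = 0)
    {p ξ : Cn n} (hp : p ∈ ringDomain n r) (htan : ∑ i, ξ i * conj (p i) = 0) :
    bergmanMetric (ringDomain n r) p ξ =
      √(deriv (radialKernel r e) (‖p‖ ^ 2) / radialKernel r e (‖p‖ ^ 2) * ‖ξ‖ ^ 2) := by
  have hpos := radialKernel_pos hr he (sq_nonneg ‖p‖) (norm_sq_lt_one hp)
  have hcd := contDiffAt_radialKernel hr he (sq_nonneg ‖p‖) (norm_sq_lt_one hp)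
  have hlevi := leviForm_comp_norm_sq (ψ := fun t => Real.log (radialKernel r e t))
    (u := logKernelDiag (ringDomain n r)) (hcd.log hpos.ne')
    (by
      filter_upwards [(isOpen_ringDomain n r).mem_nhds hp] with z hz
      exact logKernelDiag_ringDomain hr he hperp hz) htan
  rw [bergmanMetric, hlevi, Complex.ofReal_re,
    deriv.log (hcd.differentiableAt (by simp)) hpos.ne']

/-- The logarithmic derivative of the radial kernel is smaller for the ring than for the ball. -/
theorem logDeriv_radialKernel_lt (hr0 : 0 < r) (hr1 : r < 1) (he : ‖e‖ = 1) {t : ℝ}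
    (ht0 : 0 < t) (ht1 : t < 1) :
    deriv (radialKernel r e) t / radialKernel r e t <
      deriv (radialKernel (-1) e) t / radialKernel (-1) e t := by
  have hm1 : (-1 : ℝ) < 1 := by norm_num
  -- Positivity of n keeps 1 - r^{2(n+k)} positive at k = 0.
  have hn : n ≠ 0 := by
    rintro rfl
    rw [Subsingleton.elim e 0, norm_zero] at he
    exact zero_ne_one he
  -- The ratio of ring to ball coefficients, by scaling.
  set a : ℕ → ℝ := fun k => (1 - r ^ (2 * (n + k)))⁻¹ with ha_def
  have hlt1 : ∀ k, r ^ (2 * (n + k)) < 1 := fun k => pow_lt_one₀ hr0.le hr1 (by omega)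
  have ha : StrictAnti a := strictAnti_nat_of_succ_lt fun k => by
    have h : r ^ (2 * (n + (k + 1))) < r ^ (2 * (n + k)) :=
      pow_lt_pow_right_of_lt_one₀ hr0 hr1 (by omega)
    exact inv_strictAnti₀ (by linarith [hlt1 k]) (by linarith)
  have hcoef : ∀ k, (ringMoment r e k)⁻¹ * t ^ k = a k * ((ringMoment (-1) e k)⁻¹ * t ^ k) := by
    intro k
    rw [ringMoment_eq_mul_ballMoment hr0 hr1, mul_inv, mul_assoc]
  have hΩ := hasSum_mul_deriv_radialKernel hr1 he ht0.le ht1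
  have hB := hasSum_mul_deriv_radialKernel hm1 he ht0.le ht1
  have hsΩ := summable_inv_ringMoment_mul_pow hr1 he ht0.le ht1
  have hsB := summable_inv_ringMoment_mul_pow hm1 he ht0.le ht1
  have hKΩ : radialKernel r e t = ∑' k, a k * ((ringMoment (-1) e k)⁻¹ * t ^ k) :=
    tsum_congr hcoef
  simp only [hcoef] at hΩ hsΩ
  have key := tsum_mul_tsum_lt_of_strictAnti
    (fun k => mul_pos (inv_pos.2 (ringMoment_pos hm1 he k)) (pow_pos ht0 k)) ha
    hsB hB.summable hsΩ hΩ.summable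
  rw [hΩ.tsum_eq, hB.tsum_eq, ← hKΩ] at key
  change _ * radialKernel (-1) e t < _ at key
  rw [div_lt_div_iff₀ (radialKernel_pos hr1 he ht0.le ht1) (radialKernel_pos hm1 he ht0.le ht1)]
  rw [mul_assoc, mul_assoc] at key
  exact lt_of_mul_lt_mul_left key ht0.le

end RadialKernel

/-- An isometry carrying p/‖p‖ to e carries ξ/‖ξ‖ to a unit vector orthogonal to e. Thus the single
pair (p, ξ) supplies a transverse direction for every axis. -/
theorem exists_unit_orthogonal {n : ℕ} {p ξ : Cn n} (hp : p ≠ 0) (hξ : ξ ≠ 0)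
    (h : inner ℂ p ξ = 0) (e : Cn n) (he : ‖e‖ = 1) : ∃ u : Cn n, ‖u‖ = 1 ∧ inner ℂ e u = 0 := by
  have hunit : ∀ x : Cn n, x ≠ 0 → ‖((‖x‖ : ℂ)⁻¹) • x‖ = 1 := fun x hx => by
    rw [norm_smul, norm_inv, Complex.norm_real, norm_norm, inv_mul_cancel₀ (norm_ne_zero_iff.2 hx)]
  obtain ⟨T, hT⟩ := exists_linearIsometry_apply_eq (hunit p hp) he
  refine ⟨T (((‖ξ‖ : ℂ)⁻¹) • ξ), by rw [T.norm_map, hunit ξ hξ], ?_⟩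
  rw [← hT, T.inner_map_map, inner_smul_left, inner_smul_right, h, mul_zero, mul_zero]

theorem theorem2 (n : ℕ) (r : ℝ) (hr0 : 0 < r) (hr1 : r < 1)
    (p : Cn n) (hp : p ∈ ringDomain n r)
    (ξ : Cn n) (hξ : ξ ≠ 0) (htan : ∑ i, ξ i * conj (p i) = 0) :
    HasBergmanMetric (ringDomain n r) ∧ HasBergmanMetric (unitBall n) ∧
      bergmanMetric (ringDomain n r) p ξ < bergmanMetric (unitBall n) p ξ := by
  have hm1 : (-1 : ℝ) < 1 := by norm_num
  have hpn : 0 < ‖p‖ := hr0.trans hp.1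
  have hp0 : p ≠ 0 := norm_pos_iff.1 hpn
  have hperp := exists_unit_orthogonal hp0 hξ (by rw [PiLp.inner_apply]; exact htan)
  have hpB : p ∈ ringDomain n (-1) := ⟨by linarith, hp.2⟩
  have hpn' : (‖p‖ : ℂ) ≠ 0 := by simpa using hp0
  have he : ‖((‖p‖ : ℂ)⁻¹) • p‖ = 1 := by
    rw [norm_smul, norm_inv, Complex.norm_real, norm_norm, inv_mul_cancel₀ hpn.ne']
  have ht1 := norm_sq_lt_one hp
  rw [unitBall_eq_ringDomain]
  refine ⟨hasBergmanMetric_ringDomain hr1 he hperp, hasBergmanMetric_ringDomain hm1 he hperp, ?_⟩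
  rw [bergmanMetric_ringDomain_of_tangential hr1 he hperp hp htan,
    bergmanMetric_ringDomain_of_tangential hm1 he hperp hpB htan]
  refine Real.sqrt_lt_sqrt (mul_nonneg (div_nonneg
    (deriv_radialKernel_nonneg hr1 he (sq_nonneg _) ht1)
    (radialKernel_pos hr1 he (sq_nonneg _) ht1).le) (sq_nonneg _)) ?_
  exact mul_lt_mul_of_pos_right (logDeriv_radialKernel_lt hr0 hr1 he (by positivity) ht1)
    (pow_pos (norm_pos_iff.2 hξ) 2)
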